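/- Let $1\le k\le n$ be integers and let $R>0$. An apartment with $k$ rooms and total rent $R$ is offered to $n$ tenants. A price distribution is a vector $p=(p_1,\dots,p_k)$ of nonnegative real numbers with $p_1+\dots+p_k=R$. For every price distribution $p$, each tenant $i\in\{1,\dots,n\}$ has a (possibly empty) set $A_i(p)\subseteq\{1,\dots,k\}$ of rooms that the tenant is willing to rent at these prices. Assume the following. (1) The preferences are closed: for every tenant $i$ and every room $j$, the set of price distributions $p$ with $j\in A_i(p)$ is closed. (2) If some room is free, a tenant accepts only free rooms: for every tenant $i$ and every price distribution $p$ having some zero coordinate, $p_j=0$ for all $j\in A_i(p)$. (3) For every price distribution $p$ and every set $C$ of exactly $n-k+1$ tenants, there is a tenant $i\in C$ with $A_i(p)\neq\emptyset$. Then there are a price distribution $p$ and $k$ distinct tenants $i_1,\dots,i_k$ such that $j\in A_{i_j}(p)$ for every $j\in\{1,\dots,k\}$; that is, $k$ of the tenants can be assigned different rooms so that each is willing to rent the assigned room at the prices $p$. -/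

import Mathlib

/-- A price distribution of `k` rooms with total rent `R`: a nonnegative price for each room, the
prices adding up to `R`. It carries the subspace topology of `Fin k → ℝ`. -/
abbrev PriceDistribution (k : ℕ) (R : ℝ) : Type :=
  {p : Fin k → ℝ // (∀ j, 0 ≤ p j) ∧ ∑ j, p j = R}

/-- The preferences of one tenant: at every price distribution, the (possibly empty) set of rooms
that the tenant is willing to rent. -/
abbrev Preferences (k : ℕ) (R : ℝ) : Type :=
  PriceDistribution k R → Set (Fin k)

/-- For every room, the set of price distributions at which the tenant accepts it is closed. -/
def Preferences.HasClosedPreferences {k : ℕ} {R : ℝ} (A : Preferences k R) : Prop :=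
  ∀ j : Fin k, IsClosed {p : PriceDistribution k R | j ∈ A p}

/-- Whenever some room is free, the tenant accepts only free rooms. -/
def Preferences.AcceptsOnlyFreeIfFree {k : ℕ} {R : ℝ} (A : Preferences k R) : Prop :=
  ∀ p : PriceDistribution k R, (∃ j', p.1 j' = 0) → ∀ j ∈ A p, p.1 j = 0

/-! Bump functions that are 1 where tenant `i` accepts room `j` and vanish off a neighbourhood of
that set are capped and rescaled into a nonnegative tenant-by-room matrix, continuous in the prices.
By (3) at least `k` tenants accept something at any prices, so its total can be made `k` with row
sums at most 1. Some column sum is then at least 1 at every `p`, so these conditions define a closed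
cover, and `exists_mem_closed_cover` yields a `p` at which each room has column sum at least 1 or is
free. A deficient column would make its room free; then (2), in the approximate form "cheaper than
`R / k`", makes every room too cheap for the prices to add up to `R`. So all column sums are at
least 1 and Hall's theorem gives an assignment. Shrinking neighbourhoods and compactness finish the
proof.

The covering theorem needs no triangulation: in Scarf's manner, dominant sets of lattice points of a
dilated simplex act as cells. `even_card_extend_facet` is the pivot step that lets Sperner's parity
count produce a rainbow cell. -/

/-- With respect to the orders given by the rank functions `r i`, no element lies strictly above the
minimum of `T` in every order at once. -/
def IsDominant {I Y : Type*} (r : I → Y → ℕ) (T : Finset Y) : Prop :=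
  ∀ y, ∃ i, ∀ x ∈ T, r i y ≤ r i x

theorem IsDominant.mono {I Y : Type*} {r : I → Y → ℕ} {S T : Finset Y} (hT : IsDominant r T)
    (h : S ⊆ T) : IsDominant r S := fun y =>
  (hT y).imp fun _ hi x hx => hi x (h hx)

/-! ### Sperner's parity argument -/

section Sperner

variable {I Y : Type*} [Fintype I] [DecidableEq I] [DecidableEq Y]

/-- A set of `card I` elements that is not rainbow has an even number of elements whose removal
leaves all colours but `i₀`. -/
theorem even_card_filter_image_erase (c : Y → I) (i₀ : I) (T : Finset Y)
    (hT : T.card = Fintype.card I) (hc : T.image c ≠ Finset.univ) :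
    Even (T.filter fun x => (T.erase x).image c = Finset.univ.erase i₀).card := by
  by_cases hne : (T.filter fun x => (T.erase x).image c = Finset.univ.erase i₀) = ∅
  · simp [hne]
  obtain ⟨x, hx⟩ := Finset.nonempty_iff_ne_empty.mpr hne
  rw [Finset.mem_filter] at hx
  obtain ⟨hxT, hx⟩ := hx
  have hcard : ∀ z ∈ T, (T.erase z).card = (Finset.univ.erase i₀).card := by
    intro z hz
    rw [Finset.card_erase_of_mem hz, Finset.card_erase_of_mem (Finset.mem_univ _), hT,
      Finset.card_univ]
  have hinj : ∀ z ∈ T, (T.erase z).image c = Finset.univ.erase i₀ →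
      Set.InjOn c (T.erase z : Finset Y) := by
    intro z hz h
    apply Finset.injOn_of_card_image_eq
    rw [h, hcard z hz]
  have hcx : c x ≠ i₀ := by
    intro h
    apply hc
    rw [← Finset.insert_erase hxT, Finset.image_insert, hx, h,
      Finset.insert_erase (Finset.mem_univ _)]
  obtain ⟨y, hy, hyx⟩ : ∃ y ∈ T.erase x, c y = c x := by
    rw [← Finset.mem_image, hx]
    simp [hcx]
  rw [Finset.mem_erase] at hy
  -- In `T` only `x` and `y` share a colour, so removing any third element leaves a repetition and
  -- loses a colour.
  have : (T.filter fun z => (T.erase z).image c = Finset.univ.erase i₀) = {x, y} := by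
    ext z
    simp only [Finset.mem_filter, Finset.mem_insert, Finset.mem_singleton]
    constructor
    · rintro ⟨hz, h⟩
      by_contra! hzz
      exact hy.1 (hinj z hz h (by simp [hy.2, hzz.2.symm]) (by simp [hxT, hzz.1.symm]) hyx)
    · rintro (rfl | rfl)
      · exact ⟨hxT, hx⟩
      · refine ⟨hy.2, ?_⟩
        rw [← hx]
        ext i
        simp only [Finset.mem_image, Finset.mem_erase]
        constructor
        · rintro ⟨w, ⟨hw1, hw2⟩, rfl⟩
          by_cases hwx : w = x
          · exact ⟨z, ⟨hy.1, hy.2⟩, by rw [hyx, hwx]⟩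
          · exact ⟨w, ⟨hwx, hw2⟩, rfl⟩
        · rintro ⟨w, ⟨hw1, hw2⟩, rfl⟩
          by_cases hwy : w = z
          · exact ⟨x, ⟨hy.1.symm, hxT⟩, by rw [← hyx, hwy]⟩
          · exact ⟨w, ⟨hwy, hw2⟩, rfl⟩
  rw [this, Finset.card_pair hy.1.symm]
  exact even_two

/-- Sperner's parity argument: if among the facets coloured by all colours but `i₀` exactly one lies
in an odd number of cells, then some cell is rainbow. -/
theorem exists_rainbow_of_parity [Fintype Y] (c : Y → I) (i₀ : I) (rooms : Finset (Finset Y))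
    (hrooms : ∀ T ∈ rooms, T.card = Fintype.card I) (S₀ : Finset Y)
    (hS₀ : S₀.image c = Finset.univ.erase i₀) (hS₀card : S₀.card + 1 = Fintype.card I)
    (hodd : Odd (rooms.filter (S₀ ⊆ ·)).card)
    (heven : ∀ S : Finset Y, S.card + 1 = Fintype.card I → S.image c = Finset.univ.erase i₀ →
      S ≠ S₀ → Even (rooms.filter (S ⊆ ·)).card) :
    ∃ T ∈ rooms, T.image c = Finset.univ := by
  classical
  by_contra! hno
  set doors : Finset (Finset Y) := Finset.univ.filter fun S =>
    S.card + 1 = Fintype.card I ∧ S.image c = Finset.univ.erase i₀ with hdoors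
  have hcount := Finset.sum_card_bipartiteAbove_eq_sum_card_bipartiteBelow
    (s := doors) (t := rooms) (fun S T => S ⊆ T)
  have hright : Even (∑ T ∈ rooms, (doors.bipartiteBelow (fun S T => S ⊆ T) T).card) := by
    refine Finset.even_sum _ fun T hT => ?_
    have h := even_card_filter_image_erase c i₀ T (hrooms T hT) (hno T hT)
    have himg : doors.bipartiteBelow (fun S T => S ⊆ T) T =
        (T.filter fun x => (T.erase x).image c = Finset.univ.erase i₀).image T.erase := by
      ext S
      simp only [Finset.bipartiteBelow, hdoors, Finset.mem_filter, Finset.mem_univ, true_and,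
        Finset.mem_image]
      constructor
      · rintro ⟨⟨h1, h2⟩, h3⟩
        have h4 : (T \ S).card = 1 := by
          rw [Finset.card_sdiff_of_subset h3, hrooms T hT]
          omega
        obtain ⟨x, hx⟩ := Finset.card_eq_one.mp h4
        have hxT : x ∈ T \ S := by simp [hx]
        have hS : T.erase x = S := by
          rw [Finset.erase_eq, ← hx, Finset.sdiff_sdiff_eq_self h3]
        exact ⟨x, ⟨(Finset.mem_sdiff.mp hxT).1, by rw [hS, h2]⟩, hS⟩
      · rintro ⟨x, ⟨h1, h2⟩, rfl⟩
        refine ⟨⟨?_, h2⟩, Finset.erase_subset _ _⟩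
        rw [Finset.card_erase_add_one h1, hrooms T hT]
    rw [himg, Finset.card_image_of_injOn]
    · exact h
    · intro x hx y hy hxy
      exact Finset.erase_injOn T (Finset.mem_filter.mp hx).1 (Finset.mem_filter.mp hy).1 hxy
  have hmem : S₀ ∈ doors := by simp [hdoors, hS₀, hS₀card]
  have hleft : Odd (∑ S ∈ doors, (rooms.bipartiteAbove (fun S T => S ⊆ T) S).card) := by
    rw [← Finset.add_sum_erase _ _ hmem]
    refine Odd.add_even hodd (Finset.even_sum _ fun S hS => ?_)
    rw [Finset.mem_erase, hdoors, Finset.mem_filter] at hS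
    exact heven S hS.2.2.1 hS.2.2.2 hS.1
  rw [hcount] at hleft
  exact (Nat.not_even_iff_odd.mpr hleft) hright

end Sperner

/-! ### Dominant cells and their facets -/

section Dominant

variable {I Y : Type*} [Fintype I] [DecidableEq Y] [Fintype Y] {r : I → Y → ℕ}

/-- The sets of `card I` elements containing a facet correspond to the elements outside of it. -/
theorem card_dominant_supersets [DecidablePred (IsDominant r)] (S : Finset Y)
    (hS : S.card + 1 = Fintype.card I) :
    ((Finset.univ.filter fun T : Finset Y => T.card = Fintype.card I ∧ IsDominant r T).filter
      (S ⊆ ·)).card =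
    (Finset.univ.filter fun x => x ∉ S ∧ IsDominant r (insert x S)).card := by
  symm
  refine Finset.card_bij (fun x _ => insert x S) ?_ ?_ ?_
  · intro x hx
    simp only [Finset.mem_filter, Finset.mem_univ, true_and] at hx ⊢
    exact ⟨⟨by rw [Finset.card_insert_of_notMem hx.1, hS], hx.2⟩, Finset.subset_insert _ _⟩
  · intro x hx y hy hxy
    simp only [Finset.mem_filter, Finset.mem_univ, true_and] at hx hy
    have : x ∈ insert y S := hxy ▸ Finset.mem_insert_self x S
    simpa [hx.1] using this
  · intro T hT
    simp only [Finset.mem_filter, Finset.mem_univ, true_and] at hT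
    obtain ⟨⟨h1, h2⟩, h3⟩ := hT
    have h4 : (T \ S).card = 1 := by
      rw [Finset.card_sdiff_of_subset h3]
      omega
    obtain ⟨x, hx⟩ := Finset.card_eq_one.mp h4
    have hxT : x ∈ T \ S := by simp [hx]
    have hins : insert x S = T := by
      rw [Finset.insert_eq, ← hx, Finset.sdiff_union_of_subset h3]
    refine ⟨x, ?_, hins⟩
    simp only [Finset.mem_filter, Finset.mem_univ, true_and]
    exact ⟨(Finset.mem_sdiff.mp hxT).2, hins ▸ h2⟩

/-- The facet of all slack elements `e j` with `j ≠ i₀` lies in exactly one dominant cell. -/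
theorem card_extend_slack_facet [DecidableEq I] [DecidablePred (IsDominant r)]
    (hr : ∀ i, Function.Injective (r i))
    (e : I → Y) (he : Function.Injective e)
    (hmin : ∀ i y, r i (e i) ≤ r i y)
    (hmax : ∀ i j y, j ≠ i → y ∉ Set.range e → r i y < r i (e j)) (i₀ : I) :
    (Finset.univ.filter fun x => x ∉ (Finset.univ.erase i₀).image e ∧
      IsDominant r (insert x ((Finset.univ.erase i₀).image e))).card = 1 := by
  have hmemS : ∀ y, y ∈ (Finset.univ.erase i₀).image e ↔ ∃ j, j ≠ i₀ ∧ e j = y := by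
    intro y; simp
  have hlt : ∀ i y, y ≠ e i → r i (e i) < r i y := fun i y h =>
    lt_of_le_of_ne (hmin i y) fun h' => h (hr i h'.symm)
  -- For `j ≠ i₀` the `j`-minimum of the cell is `e j`, the global minimum, so order `j` cannot
  -- serve a `y` outside the facet; only order `i₀` matters.
  have hiff : ∀ x, IsDominant r (insert x ((Finset.univ.erase i₀).image e)) ↔
      ∀ y, y ∉ (Finset.univ.erase i₀).image e → r i₀ y ≤ r i₀ x := by
    intro x
    constructor
    · intro hd y hy
      by_cases hye : y = e i₀
      · exact hye ▸ hmin i₀ x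
      obtain ⟨i, hi⟩ := hd y
      by_cases hii : i = i₀
      · exact hii ▸ hi x (Finset.mem_insert_self _ _)
      · exfalso
        have := hi (e i) (Finset.mem_insert_of_mem ((hmemS _).mpr ⟨i, hii, rfl⟩))
        have h2 := hlt i y (fun h => hy ((hmemS _).mpr ⟨i, hii, h.symm⟩))
        omega
    · intro h y
      by_cases hy : y ∈ (Finset.univ.erase i₀).image e
      · obtain ⟨j, -, rfl⟩ := (hmemS y).mp hy
        exact ⟨j, fun x _ => hmin j x⟩
      · refine ⟨i₀, fun x' hx' => ?_⟩
        rcases Finset.mem_insert.mp hx' with rfl | hx'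
        · exact h y hy
        · obtain ⟨j, hj, rfl⟩ := (hmemS x').mp hx'
          by_cases hye : y = e i₀
          · exact hye ▸ hmin i₀ _
          · refine (hmax i₀ j y hj ?_).le
            rintro ⟨l, rfl⟩
            exact hy ((hmemS _).mpr ⟨l, fun h => hye (h ▸ rfl), rfl⟩)
  have hne : (Finset.univ.filter fun y => y ∉ (Finset.univ.erase i₀).image e).Nonempty := by
    refine ⟨e i₀, ?_⟩
    rw [Finset.mem_filter, hmemS]
    refine ⟨Finset.mem_univ _, ?_⟩
    rintro ⟨j, hj, h⟩
    exact hj (he h)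
  obtain ⟨x, hx, hxmax⟩ := Finset.exists_max_image _ (r i₀) hne
  rw [Finset.card_eq_one]
  refine ⟨x, ?_⟩
  ext z
  simp only [Finset.mem_filter, Finset.mem_univ, true_and, Finset.mem_singleton, hiff] at hx hxmax ⊢
  constructor
  · rintro ⟨h1, h2⟩
    exact hr i₀ (le_antisymm (hxmax z h1) (h2 x hx))
  · rintro rfl
    exact ⟨hx, hxmax⟩

/-- A facet that does not consist of slack elements lies in either no or two dominant cells. -/
theorem even_card_extend_facet [DecidablePred (IsDominant r)] (hr : ∀ i, Function.Injective (r i))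
    (e : I → Y) (hmax : ∀ i j y, j ≠ i → y ∉ Set.range e → r i y < r i (e j))
    (S : Finset Y) (hS : S.card + 1 = Fintype.card I) (hSe : ∃ y ∈ S, y ∉ Set.range e) :
    Even (Finset.univ.filter fun x => x ∉ S ∧ IsDominant r (insert x S)).card := by
  classical
  by_cases hdom : IsDominant r S
  swap
  · rw [Finset.filter_eq_empty_iff.mpr]
    · simp
    · rintro x - ⟨-, h⟩
      exact hdom (h.mono (Finset.subset_insert _ _))
  obtain ⟨y₀, hy₀S, hy₀⟩ := hSe
  have hex : ∀ i, ∃ x ∈ S, ∀ z ∈ S, r i x ≤ r i z := fun i =>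
    Finset.exists_min_image S (r i) ⟨y₀, hy₀S⟩
  choose m hmS hm using hex
  have hsurj : ∀ x ∈ S, ∃ i, m i = x := by
    intro x hx
    obtain ⟨i, hi⟩ := hdom x
    exact ⟨i, hr i (le_antisymm (hm i x hx) (hi _ (hmS i)))⟩
  -- `m` maps the orders onto `S`, which has one element fewer, so `{a, b}` is its only fibre with
  -- two elements. The two extensions of `S` take over the minimum in order `a` or in order `b`.
  obtain ⟨a, -, b, -, hab, hmab⟩ := Finset.exists_ne_map_eq_of_card_lt_of_maps_to
    (s := Finset.univ) (t := S) (f := m) (by rw [Finset.card_univ]; omega) (fun i _ => hmS i)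
  have hinj : ∀ a b, a ≠ b → m a = m b → ∀ i j, i ≠ a → j ≠ a → m i = m j → i = j := by
    intro a b hab hmab i j hi hj hij
    have himg : (Finset.univ.erase a).image m = S := by
      ext x
      simp only [Finset.mem_image, Finset.mem_erase, Finset.mem_univ, and_true]
      constructor
      · rintro ⟨i, -, rfl⟩; exact hmS i
      · intro hx
        obtain ⟨i, rfl⟩ := hsurj x hx
        by_cases hia : i = a
        · exact ⟨b, hab.symm, by rw [hia, hmab]⟩
        · exact ⟨i, hia, rfl⟩
    have hI : Set.InjOn m (Finset.univ.erase a : Finset I) := by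
      apply Finset.injOn_of_card_image_eq
      rw [himg, Finset.card_erase_of_mem (Finset.mem_univ _), Finset.card_univ]
      omega
    exact hI (by simp [hi]) (by simp [hj]) hij
  have hnonempty : ∀ a, (Finset.univ.filter fun x => ∀ i, i ≠ a → r i (m i) < r i x).Nonempty := by
    intro a
    -- The non-slack `y₀` is needed here: `e a` lies above it, hence above the minimum of `S`, in
    -- all orders but the `a`-th.
    refine ⟨e a, ?_⟩
    simp only [Finset.mem_filter, Finset.mem_univ, true_and]
    intro i hi
    exact lt_of_le_of_lt (hm i y₀ hy₀S) (hmax i a y₀ hi.symm hy₀)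
  have hmaxex : ∀ a, ∃ x, (∀ i, i ≠ a → r i (m i) < r i x) ∧
      ∀ z, (∀ i, i ≠ a → r i (m i) < r i z) → r a z ≤ r a x := by
    intro a
    obtain ⟨x, hx, hx'⟩ := Finset.exists_max_image _ (r a) (hnonempty a)
    simp only [Finset.mem_filter, Finset.mem_univ, true_and] at hx hx'
    exact ⟨x, hx, hx'⟩
  -- The top element above the minima in all orders but the `a`-th extends the facet.
  have hext : ∀ a b, a ≠ b → m a = m b → ∀ x, (∀ i, i ≠ a → r i (m i) < r i x) →
      (∀ z, (∀ i, i ≠ a → r i (m i) < r i z) → r a z ≤ r a x) →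
      x ∉ S ∧ IsDominant r (insert x S) := by
    intro a b hab hmab x hx hx'
    have hxa : r a x ≤ r a (m a) := by
      obtain ⟨i, hi⟩ := hdom x
      by_cases hia : i = a
      · exact hia ▸ hi _ (hmS i)
      · exact absurd (hi _ (hmS i)) (not_le.mpr (hx i hia))
    refine ⟨fun hxS => ?_, fun y => ?_⟩
    · obtain ⟨i, rfl⟩ := hsurj x hxS
      by_cases hia : i = a
      · have := hx b hab.symm
        rw [hia, hmab] at this
        exact lt_irrefl _ this
      · exact lt_irrefl _ (hx i hia)
    · by_contra! hcon
      have hy : ∀ i, i ≠ a → r i (m i) < r i y := by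
        intro i hi
        obtain ⟨w, hw, hwy⟩ := hcon i
        rcases Finset.mem_insert.mp hw with rfl | hw
        · exact (hx i hi).trans hwy
        · exact lt_of_le_of_lt (hm i w hw) hwy
      obtain ⟨w, hw, hwy⟩ := hcon a
      have h1 := hx' y hy
      rcases Finset.mem_insert.mp hw with rfl | hw
      · omega
      · have := hm a w hw
        omega
  have hconv : ∀ x, x ∉ S → IsDominant r (insert x S) → ∃ a', (a' = a ∨ a' = b) ∧
      (∀ i, i ≠ a' → r i (m i) < r i x) ∧
      (∀ z, (∀ i, i ≠ a' → r i (m i) < r i z) → r a' z ≤ r a' x) := by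
    intro x hxS hd
    -- The new element is the minimum in order `i`; each element of `S` must remain a minimum in
    -- another order, which forces `i` into the double fibre.
    obtain ⟨i, hi⟩ := hd x
    have hmem : ∀ s ∈ S, ∃ j, j ≠ i ∧ m j = s := by
      intro s hs
      obtain ⟨j, hj⟩ := hd s
      refine ⟨j, ?_, hr j (le_antisymm (hm j s hs) (hj _ (Finset.mem_insert_of_mem (hmS j))))⟩
      rintro rfl
      have h1 := hj x (Finset.mem_insert_self _ _)
      have h2 := hi s (Finset.mem_insert_of_mem hs)
      exact hxS (hr j (le_antisymm h2 h1) ▸ hs)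
    have hiab : i = a ∨ i = b := by
      obtain ⟨j, hji, hj⟩ := hmem (m i) (hmS i)
      by_contra! hcon
      by_cases hja : j = a
      · exact hcon.2 (hinj a b hab hmab i b hcon.1 hab.symm (by rw [← hj, hja, hmab]))
      · exact hji (hinj a b hab hmab j i hja hcon.1 hj)
    refine ⟨i, hiab, ?_, ?_⟩
    · obtain ⟨j, hji, hj⟩ := hmem (m i) (hmS i)
      intro l hl
      by_contra! hle
      -- `x` would be the minimum of the cell in both orders `i` and `l`
      obtain ⟨q, hq⟩ := hd (m l)
      have hql : q ≠ l := by
        rintro rfl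
        have h1 := hq x (Finset.mem_insert_self _ _)
        exact hxS (hr q (le_antisymm hle h1) ▸ hmS q)
      have hqi : q ≠ i := by
        rintro rfl
        have h1 := hq x (Finset.mem_insert_self _ _)
        have h2 := hi (m l) (Finset.mem_insert_of_mem (hmS l))
        exact hxS (hr q (le_antisymm h2 h1) ▸ hmS l)
      have hmq : m q = m l := by
        refine hr q (le_antisymm (hm q _ (hmS l)) (hq _ (Finset.mem_insert_of_mem (hmS q))))
      exact hql (hinj i j hji.symm hj.symm q l hqi hl hmq)
    · intro z hz
      obtain ⟨l, hl⟩ := hd z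
      by_cases hli : l = i
      · exact hli ▸ hl x (Finset.mem_insert_self _ _)
      · exact absurd (hl _ (Finset.mem_insert_of_mem (hmS l))) (not_le.mpr (hz l hli))
  obtain ⟨x, hx, hx'⟩ := hmaxex a
  obtain ⟨y, hy, hy'⟩ := hmaxex b
  have hxy : x ≠ y := by
    rintro rfl
    obtain ⟨i, hi⟩ := hdom x
    have h1 := hi _ (hmS i)
    by_cases hia : i = a
    · have := hy i (hia ▸ hab)
      omega
    · have := hx i hia
      omega
  have : (Finset.univ.filter fun x => x ∉ S ∧ IsDominant r (insert x S)) = {x, y} := by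
    ext z
    simp only [Finset.mem_filter, Finset.mem_univ, true_and, Finset.mem_insert,
      Finset.mem_singleton]
    constructor
    · rintro ⟨h1, h2⟩
      obtain ⟨a', rfl | rfl, h3, h4⟩ := hconv z h1 h2
      · exact Or.inl (hr a' (le_antisymm (hx' z h3) (h4 x hx)))
      · exact Or.inr (hr a' (le_antisymm (hy' z h3) (h4 y hy)))
    · rintro (rfl | rfl)
      · exact hext a b hab hmab z hx hx'
      · exact hext b a hab.symm hmab.symm z hy hy'
  rw [this, Finset.card_pair hxy]
  exact even_two

/-- Since `e i` has colour `i`, the only all-slack facet carrying exactly the colours other than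
`i₀` is the one omitting `e i₀`. It lies in one dominant cell, any other facet with these colours in
an even number. -/
theorem exists_rainbow_dominant [DecidableEq I] [Nonempty I]
    (hr : ∀ i, Function.Injective (r i)) (e : I → Y) (hmin : ∀ i y, r i (e i) ≤ r i y)
    (hmax : ∀ i j y, j ≠ i → y ∉ Set.range e → r i y < r i (e j))
    (c : Y → I) (hc : ∀ i, c (e i) = i) :
    ∃ T : Finset Y, IsDominant r T ∧ T.image c = Finset.univ := by
  classical
  have he : Function.Injective e := Function.LeftInverse.injective hc
  obtain ⟨i₀⟩ := ‹Nonempty I›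
  have hcard : ((Finset.univ.erase i₀).image e).card + 1 = Fintype.card I := by
    rw [Finset.card_image_of_injective _ he, Finset.card_erase_add_one (Finset.mem_univ _),
      Finset.card_univ]
  have himg : ((Finset.univ.erase i₀).image e).image c = Finset.univ.erase i₀ := by
    rw [Finset.image_image, show c ∘ e = id from funext hc, Finset.image_id]
  obtain ⟨T, hT, hTc⟩ := exists_rainbow_of_parity c i₀
    (Finset.univ.filter fun T : Finset Y => T.card = Fintype.card I ∧ IsDominant r T)
    (fun T hT => (Finset.mem_filter.mp hT).2.1) ((Finset.univ.erase i₀).image e) himg hcard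
    (by
      rw [card_dominant_supersets _ hcard, card_extend_slack_facet hr e he hmin hmax]
      exact odd_one)
    (by
      intro S hS hSc hne
      rw [card_dominant_supersets _ hS]
      refine even_card_extend_facet hr e hmax S hS ?_
      by_contra! hcon
      apply hne
      refine Finset.eq_of_subset_of_card_le (fun y hy => ?_) (by omega)
      obtain ⟨j, rfl⟩ := hcon y hy
      refine Finset.mem_image_of_mem e ?_
      rw [← hSc, ← hc j]
      simpa [hc] using Finset.mem_image_of_mem c hy)
  exact ⟨T, (Finset.mem_filter.mp hT).2.2, hTc⟩

end Dominant

/-! ### Scarf's lemma and small cells of lattice points -/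

/-- Scarf's lemma for a coloured finite set with a family of injective rank functions. -/
theorem exists_dominant_colouring {I X : Type*} [Fintype I] [DecidableEq I] [Nonempty I] [Finite X]
    (s : I → X → ℕ) (hs : ∀ i, Function.Injective (s i)) (c : X → I) :
    ∃ T : Finset X, ∀ y, ∃ i ∈ T.image c, ∀ x ∈ T, s i y ≤ s i x := by
  classical
  have := Fintype.ofFinite X
  obtain ⟨M, hM⟩ : ∃ M, ∀ i x, s i x < M := by
    obtain ⟨M, hM⟩ := (Set.finite_range fun q : I × X => s q.1 q.2).bddAbove
    exact ⟨M + 1, fun i x => Nat.lt_succ_of_le (hM ⟨(i, x), rfl⟩)⟩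
  let enc := Fintype.equivFin I
  -- Slack `j` is lowest in order `j` and above all of `X` in the others; the shift by 1 keeps rank
  -- 0 free for it.
  let r : I → X ⊕ I → ℕ := fun i => Sum.elim (fun x => s i x + 1)
    (fun j => if j = i then 0 else M + 1 + enc j)
  have hr : ∀ i, Function.Injective (r i) := by
    rintro i (x | j) (y | l) h
    · simp only [r, Sum.elim_inl, add_left_inj] at h
      rw [hs i h]
    · exfalso
      have := hM i x
      simp only [r, Sum.elim_inl, Sum.elim_inr] at h
      split_ifs at h
      omega
    · exfalso
      have := hM i y
      simp only [r, Sum.elim_inl, Sum.elim_inr] at h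
      split_ifs at h
      omega
    · simp only [r, Sum.elim_inr] at h
      split_ifs at h with h1 h2 h2
      · rw [h1, h2]
      · omega
      · omega
      · have : enc j = enc l := Fin.ext (by omega)
        rw [enc.injective this]
  obtain ⟨T, hT, hTc⟩ := exists_rainbow_dominant hr (Sum.inr : I → X ⊕ I)
    (fun i y => by simp [r])
    (by
      rintro i j (x | l) hji hy
      · have := hM i x
        simp only [r, Sum.elim_inl, Sum.elim_inr, if_neg hji]
        omega
      · exact absurd ⟨l, rfl⟩ hy)
    (Sum.elim c id) (fun i => rfl)
  refine ⟨T.toLeft, fun y => ?_⟩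
  obtain ⟨i, hi⟩ := hT (Sum.inl y)
  refine ⟨i, ?_, fun x hx => ?_⟩
  -- Slack `i`, of rank 0, cannot be the element of colour `i` in `T`, because `y` has positive
  -- rank.
  · have hmem : i ∈ T.image (Sum.elim c id) := hTc ▸ Finset.mem_univ i
    obtain ⟨x | j, hx, hxi⟩ := Finset.mem_image.mp hmem
    · exact Finset.mem_image.mpr ⟨x, Finset.mem_toLeft.mpr hx, hxi⟩
    · obtain rfl : j = i := hxi
      have := hi _ hx
      simp [r] at this
  · have := hi _ (Finset.mem_toLeft.mp hx)
    simpa [r] using this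

/-- Every colouring of the lattice points of a dilated simplex has a small cell `T` that carries all
colours but those of coordinates which are small on `T`. -/
theorem exists_small_coloured_cell {I : Type*} [Fintype I] [DecidableEq I] [Nonempty I] (N : ℕ)
    (c : {x : I → ℕ // ∑ i, x i = N} → I) :
    ∃ T : Finset {x : I → ℕ // ∑ i, x i = N}, T.Nonempty ∧
      (∀ x ∈ T, ∀ j ∉ T.image c, x.1 j ≤ Fintype.card I) ∧
      ∀ x ∈ T, ∀ y ∈ T, ∀ j, x.1 j ≤ y.1 j + Fintype.card I := by
  classical
  have hle : ∀ (x : {x : I → ℕ // ∑ i, x i = N}) (i : I), x.1 i ≤ N := fun x i =>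
    (Finset.single_le_sum (fun j _ => Nat.zero_le (x.1 j)) (Finset.mem_univ i)).trans_eq x.2
  have hfin : Finite {x : I → ℕ // ∑ i, x i = N} := by
    refine Finite.of_injective (β := I → Fin (N + 1))
      (fun x i => ⟨x.1 i, Nat.lt_succ_of_le (hle x i)⟩) fun x y h => ?_
    refine Subtype.ext (funext fun i => ?_)
    exact congrArg Fin.val (congrFun h i)
  have := Fintype.ofFinite {x : I → ℕ // ∑ i, x i = N}
  let enc := Fintype.equivFin {x : I → ℕ // ∑ i, x i = N}
  -- Order by the `i`-th coordinate, ties broken by the enumeration.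
  let s : I → {x : I → ℕ // ∑ i, x i = N} → ℕ := fun i x =>
    x.1 i * Fintype.card {x : I → ℕ // ∑ i, x i = N} + enc x
  have hlt : ∀ i x y, x.1 i < y.1 i → s i x < s i y := by
    intro i x y h
    have h1 := (enc x).2
    have h2 := Nat.mul_le_mul_right (Fintype.card {x : I → ℕ // ∑ i, x i = N})
      (Nat.succ_le_of_lt h)
    simp only [s]
    rw [Nat.succ_mul] at h2
    omega
  have hs : ∀ i, Function.Injective (s i) := by
    intro i x y h
    rcases lt_trichotomy (x.1 i) (y.1 i) with h1 | h1 | h1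
    · exact absurd h (hlt i x y h1).ne
    · simp only [s, h1, add_right_inj] at h
      exact enc.injective (Fin.ext h)
    · exact absurd h (hlt i y x h1).ne'
  obtain ⟨T, hT⟩ := exists_dominant_colouring s hs c
  have hT' : ∀ y : {x : I → ℕ // ∑ i, x i = N}, ∃ i ∈ T.image c, ∀ x ∈ T, y.1 i ≤ x.1 i := by
    intro y
    obtain ⟨i, hi, h⟩ := hT y
    exact ⟨i, hi, fun x hx => not_lt.mp fun hlt' => absurd (h x hx) (not_le.mpr (hlt i x y hlt'))⟩
  obtain ⟨i₁⟩ := ‹Nonempty I›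
  have hTne : T.Nonempty := by
    obtain ⟨i, hi, -⟩ := hT' ⟨Pi.single i₁ N, by simp⟩
    exact (Finset.image_nonempty).mp ⟨i, hi⟩
  let m : I → ℕ := fun i => T.inf' hTne fun x => x.1 i
  have hm : ∀ x ∈ T, ∀ i, m i ≤ x.1 i := fun x hx i => Finset.inf'_le _ hx
  have hm' : ∀ i, ∃ x ∈ T, m i = x.1 i := fun i => Finset.exists_mem_eq_inf' hTne _
  -- Otherwise some lattice point would exceed the minimum of `T` in every coordinate that is a
  -- colour. Thus the minima nearly exhaust `N`, and points of `T` have little freedom.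
  have hsum : N < ∑ i ∈ T.image c, (m i + 1) := by
    by_contra! hcon
    obtain ⟨i₂, hi₂⟩ : (T.image c).Nonempty := hTne.image c
    let z : I → ℕ := (fun i => if i ∈ T.image c then m i + 1 else 0) +
      Pi.single i₂ (N - ∑ i ∈ T.image c, (m i + 1))
    have hz : ∑ i, z i = N := by
      simp only [z, Pi.add_apply, Finset.sum_add_distrib, Finset.sum_ite_mem, Finset.univ_inter,
        Finset.sum_pi_single', Finset.mem_univ, if_true]
      rw [← Finset.sum_add_distrib]
      omega
    obtain ⟨i, hi, h⟩ := hT' ⟨z, hz⟩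
    obtain ⟨x, hx, hmx⟩ := hm' i
    have h1 := h x hx
    have h2 : m i + 1 ≤ z i := by
      simp only [z, Pi.add_apply, if_pos hi]
      omega
    simp only at h1
    omega
  have hcardC : (T.image c).card ≤ Fintype.card I := Finset.card_le_univ _
  rw [Finset.sum_add_distrib, Finset.sum_const, smul_eq_mul, mul_one] at hsum
  have hout : ∀ x ∈ T, ∀ j ∉ T.image c, x.1 j ≤ Fintype.card I := by
    intro x hx j hj
    have h1 : ∑ i ∈ insert j (T.image c), x.1 i ≤ N :=
      (Finset.sum_le_sum_of_subset (Finset.subset_univ _)).trans_eq x.2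
    rw [Finset.sum_insert hj] at h1
    have h2 : ∑ i ∈ T.image c, m i ≤ ∑ i ∈ T.image c, x.1 i :=
      Finset.sum_le_sum fun i _ => hm x hx i
    omega
  refine ⟨T, hTne, hout, fun x hx y hy j => ?_⟩
  by_cases hj : j ∈ T.image c
  · have h1 : ∑ i ∈ T.image c, x.1 i ≤ N :=
      (Finset.sum_le_sum_of_subset (Finset.subset_univ _)).trans_eq x.2
    have h2 : ∑ i ∈ (T.image c).erase j, m i ≤ ∑ i ∈ (T.image c).erase j, x.1 i :=
      Finset.sum_le_sum fun i _ => hm x hx i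
    rw [← Finset.add_sum_erase _ _ hj] at h1 hsum
    have := hm y hy j
    omega
  · exact (hout x hx j hj).trans (Nat.le_add_left _ _)

/-! ### Matchings from fractional matchings -/

/-- A matrix with nonnegative entries, row sums at most `1` and column sums at least `1` has a
matching of the columns into the rows along positive entries. -/
theorem exists_injective_pos_of_sums {ι κ : Type*} [Fintype ι] [Fintype κ] (x : ι → κ → ℝ)
    (hx : ∀ i j, 0 ≤ x i j) (hrow : ∀ i, ∑ j, x i j ≤ 1) (hcol : ∀ j, 1 ≤ ∑ i, x i j) :
    ∃ τ : κ → ι, Function.Injective τ ∧ ∀ j, 0 < x (τ j) j := by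
  classical
  let t : κ → Finset ι := fun j => Finset.univ.filter fun i => 0 < x i j
  obtain ⟨τ, hτ, h⟩ := (Finset.all_card_le_biUnion_card_iff_exists_injective t).mp (by
    intro J
    have h : (J.card : ℝ) ≤ ((J.biUnion t).card : ℝ) := by
      calc (J.card : ℝ) = ∑ j ∈ J, (1 : ℝ) := by simp
        _ ≤ ∑ j ∈ J, ∑ i, x i j := Finset.sum_le_sum fun j _ => hcol j
        _ = ∑ j ∈ J, ∑ i ∈ J.biUnion t, x i j := by
          refine Finset.sum_congr rfl fun j hj => ?_
          symm
          refine Finset.sum_subset (Finset.subset_univ _) fun i _ hi => ?_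
          by_contra hne
          exact hi (Finset.mem_biUnion.mpr ⟨j, hj, Finset.mem_filter.mpr
            ⟨Finset.mem_univ _, lt_of_le_of_ne (hx i j) (Ne.symm hne)⟩⟩)
        _ = ∑ i ∈ J.biUnion t, ∑ j ∈ J, x i j := Finset.sum_comm
        _ ≤ ∑ i ∈ J.biUnion t, (1 : ℝ) := Finset.sum_le_sum fun i _ =>
          (Finset.sum_le_sum_of_subset_of_nonneg (Finset.subset_univ _)
            fun j _ _ => hx i j).trans (hrow i)
        _ = ((J.biUnion t).card : ℝ) := by simp
    exact_mod_cast h)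
  exact ⟨τ, hτ, fun j => (Finset.mem_filter.mp (h j)).2⟩

/-! ### Compactness and ultralimits -/

theorem PriceDistribution.compactSpace (k : ℕ) (R : ℝ) : CompactSpace (PriceDistribution k R) := by
  suffices IsCompact {p : Fin k → ℝ | (∀ j, 0 ≤ p j) ∧ ∑ j, p j = R} from
    isCompact_iff_compactSpace.mp this
  refine (isCompact_Icc (a := (0 : Fin k → ℝ)) (b := fun _ => R)).of_isClosed_subset ?_ ?_
  · have h1 : IsClosed {p : Fin k → ℝ | ∀ j, 0 ≤ p j} := by
      simp only [Set.ofPred_forall]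
      exact isClosed_iInter fun j => isClosed_le continuous_const (continuous_apply j)
    exact h1.inter (isClosed_eq (by fun_prop) continuous_const)
  · rintro p ⟨hp, hsum⟩
    exact ⟨hp, fun j => (Finset.single_le_sum (fun i _ => hp i) (Finset.mem_univ j)).trans_eq hsum⟩

/-- This freezes finite data, a colour set or an assignment, along the ultrafilter, in place of
passing to subsequences. -/
theorem Ultrafilter.exists_eventually_eq {α β : Type*} [Finite β] (l : Ultrafilter α) (f : α → β) :
    ∃ b, ∀ᶠ a in l, f a = b := by
  obtain ⟨b, hb⟩ := Ultrafilter.eq_pure_of_finite (l.map f)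
  refine ⟨b, ?_⟩
  have : ({b} : Set β) ∈ l.map f := by
    rw [hb]
    exact Ultrafilter.mem_pure.mpr rfl
  exact Ultrafilter.mem_map.mp this

/-- A sequence that stays close to points of a closed set has its ultralimit in that set. -/
theorem mem_of_tendsto_of_eventually_near {X : Type*} [PseudoMetricSpace X] {l : Ultrafilter ℕ}
    (hl : (l : Filter ℕ) ≤ Filter.atTop) {u : ℕ → X} {p : X}
    (hu : Filter.Tendsto u l (nhds p)) {B : Set X} (hB : IsClosed B) (M : ℝ)
    (h : ∀ᶠ m in (l : Filter ℕ), ∃ b ∈ B, dist (u m) b ≤ M * (1 / ((m : ℝ) + 1))) : p ∈ B := by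
  obtain ⟨q, hq⟩ := h.choice
  refine hB.mem_of_tendsto (f := q) (b := (l : Filter ℕ)) ?_ (hq.mono fun m hm => hm.1)
  refine hu.congr_dist ?_
  refine squeeze_zero' (Filter.Eventually.of_forall fun _ => dist_nonneg)
    (hq.mono fun m hm => hm.2) ?_
  have := (tendsto_one_div_add_atTop_nhds_zero_nat (𝕜 := ℝ)).const_mul M
  rw [mul_zero] at this
  exact this.mono_left hl

/-! ### Closed covers of the simplex -/

/-- The price distribution proportional to a lattice point of the dilated simplex. -/
noncomputable def PriceDistribution.ofLattice {k : ℕ} {R : ℝ} (hR : 0 < R) {N : ℕ} (hN : 0 < N)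
    (x : {x : Fin k → ℕ // ∑ i, x i = N}) : PriceDistribution k R :=
  ⟨fun i => R * x.1 i / N, fun i => by positivity, by
    have h : ((∑ i, x.1 i : ℕ) : ℝ) = N := by rw [x.2]
    rw [← Finset.sum_div, ← Finset.mul_sum, ← Nat.cast_sum, h]
    have : (N : ℝ) ≠ 0 := by positivity
    field_simp⟩

/-- For every closed cover of the simplex indexed by the coordinates there is a point that lies in
all those members of the cover whose coordinate does not vanish at it. -/
theorem exists_mem_closed_cover {k : ℕ} (hk : 0 < k) {R : ℝ} (hR : 0 < R)
    (F : Fin k → Set (PriceDistribution k R)) (hF : ∀ j, IsClosed (F j))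
    (hcover : ∀ p, ∃ j, p ∈ F j) :
    ∃ p : PriceDistribution k R, ∀ j, p ∈ F j ∨ p.1 j = 0 := by
  have := PriceDistribution.compactSpace k R
  have : Nonempty (Fin k) := ⟨⟨0, hk⟩⟩
  choose c hc using hcover
  have hstep : ∀ m : ℕ, ∃ (C : Finset (Fin k)) (p : PriceDistribution k R),
      (∀ j ∉ C, p.1 j ≤ R * k * (1 / ((m : ℝ) + 1))) ∧
      ∀ j ∈ C, ∃ q ∈ F j, dist p q ≤ R * k * (1 / ((m : ℝ) + 1)) := by
    intro m
    obtain ⟨T, ⟨x, hx⟩, hout, hdist⟩ := exists_small_coloured_cell (m + 1)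
      fun x => c (PriceDistribution.ofLattice hR m.succ_pos x)
    rw [Fintype.card_fin] at hout hdist
    refine ⟨T.image fun x => c (PriceDistribution.ofLattice hR m.succ_pos x),
      PriceDistribution.ofLattice hR m.succ_pos x, fun j hj => ?_, fun j hj => ?_⟩
    · have h : (x.1 j : ℝ) ≤ k := by exact_mod_cast hout x hx j hj
      simp only [PriceDistribution.ofLattice]
      push_cast
      rw [mul_one_div]
      gcongr
    · obtain ⟨y, hy, rfl⟩ := Finset.mem_image.mp hj
      refine ⟨_, hc _, ?_⟩
      rw [Subtype.dist_eq, dist_pi_le_iff (by positivity)]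
      intro i
      have h1 : (x.1 i : ℝ) ≤ y.1 i + k := by exact_mod_cast hdist x hx y hy i
      have h2 : (y.1 i : ℝ) ≤ x.1 i + k := by exact_mod_cast hdist y hy x hx i
      simp only [PriceDistribution.ofLattice, Real.dist_eq]
      push_cast
      rw [← sub_div, ← mul_sub, abs_div, abs_mul, abs_of_pos hR,
        abs_of_pos (by positivity : (0 : ℝ) < m + 1), mul_one_div]
      gcongr
      rw [abs_le]
      constructor <;> linarith
  choose C p hout hin using hstep
  have hl := Nat.hyperfilter_le_atTop
  obtain ⟨C₀, hC₀⟩ := (Filter.hyperfilter ℕ).exists_eventually_eq C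
  have hlim : Filter.Tendsto p (Filter.hyperfilter ℕ)
      (nhds ((Filter.hyperfilter ℕ).map p).lim) := ((Filter.hyperfilter ℕ).map p).le_nhds_lim
  refine ⟨((Filter.hyperfilter ℕ).map p).lim, fun j => ?_⟩
  by_cases hj : j ∈ C₀
  · left
    refine mem_of_tendsto_of_eventually_near hl hlim (hF j) (R * k) ?_
    filter_upwards [hC₀] with m hm
    exact hin m j (hm ▸ hj)
  · right
    refine le_antisymm ?_ (((Filter.hyperfilter ℕ).map p).lim.2.1 j)
    have h1 : Filter.Tendsto (fun m => (p m).1 j) (Filter.hyperfilter ℕ) (nhds _) :=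
      (((continuous_apply j).comp continuous_subtype_val).tendsto _).comp hlim
    have h2 := (tendsto_one_div_add_atTop_nhds_zero_nat (𝕜 := ℝ)).const_mul (R * k)
    rw [mul_zero] at h2
    refine le_of_tendsto_of_tendsto h1 (h2.mono_left hl) ?_
    filter_upwards [hC₀] with m hm
    exact hout m j (hm ▸ hj)

/-! ### The rental theorem -/

/-- The rental theorem for open neighbourhoods `U i j` of the closed sets `B i j` of price
distributions at which tenant `i` accepts room `j`. -/
theorem exists_assignment_of_isOpen {k n : ℕ} (hk : 0 < k) {R : ℝ} (hR : 0 < R)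
    (B U : Fin n → Fin k → Set (PriceDistribution k R)) (hB : ∀ i j, IsClosed (B i j))
    (hUo : ∀ i j, IsOpen (U i j)) (hBU : ∀ i j, B i j ⊆ U i j)
    (hU : ∀ i j, ∀ p ∈ U i j, (∃ j', p.1 j' = 0) → p.1 j < R / k)
    (hmany : ∀ p, ∃ S : Finset (Fin n), k ≤ S.card ∧ ∀ i ∈ S, ∃ j, p ∈ B i j) :
    ∃ (p : PriceDistribution k R) (τ : Fin k → Fin n),
      Function.Injective τ ∧ ∀ j, p ∈ U (τ j) j := by
  have hk' : (0 : ℝ) < k := by exact_mod_cast hk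
  have hex : ∀ i j, ∃ f : C(PriceDistribution k R, ℝ), Set.EqOn f 0 (U i j)ᶜ ∧
      Set.EqOn f 1 (B i j) ∧ ∀ p, f p ∈ Set.Icc (0 : ℝ) 1 := fun i j =>
    exists_continuous_zero_one_of_isClosed (hUo i j).isClosed_compl (hB i j)
      (Set.disjoint_left.mpr fun p hp hp' => hp (hBU i j hp'))
  choose f hf0 hf1 hf using hex
  let s : Fin n → PriceDistribution k R → ℝ := fun i p => ∑ j, f i j p
  let t : PriceDistribution k R → ℝ := fun p => ∑ i, min (s i p) 1
  have hs0 : ∀ i p, 0 ≤ s i p := fun i p => Finset.sum_nonneg fun j _ => (hf i j p).1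
  have ht : ∀ p, (k : ℝ) ≤ t p := by
    intro p
    obtain ⟨S, hS, hSB⟩ := hmany p
    calc (k : ℝ) ≤ S.card := by exact_mod_cast hS
      _ = ∑ i ∈ S, (1 : ℝ) := by simp
      _ ≤ ∑ i ∈ S, min (s i p) 1 := by
        refine Finset.sum_le_sum fun i hi => le_min ?_ le_rfl
        obtain ⟨j, hj⟩ := hSB i hi
        have h1 : f i j p = 1 := hf1 i j hj
        rw [← h1]
        exact Finset.single_le_sum (f := fun j => f i j p) (fun j _ => (hf i j p).1)
          (Finset.mem_univ j)
      _ ≤ t p := Finset.sum_le_sum_of_subset_of_nonneg (Finset.subset_univ _)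
        fun i _ _ => le_min (hs0 i p) zero_le_one
  have ht0 : ∀ p, 0 < t p := fun p => hk'.trans_le (ht p)
  have hmax : ∀ i p, 0 < max (s i p) 1 := fun i p => lt_max_of_lt_right one_pos
  -- Dividing by `max (s i p) 1` caps the `i`-th row sum at `min (s i p) 1`; the factor `k / t p`,
  -- at most 1, makes the total `k`.
  let x : PriceDistribution k R → Fin n → Fin k → ℝ := fun p i j =>
    k * f i j p / (max (s i p) 1 * t p)
  have hx0 : ∀ p i j, 0 ≤ x p i j := fun p i j =>
    div_nonneg (mul_nonneg hk'.le (hf i j p).1) (mul_pos (hmax i p) (ht0 p)).le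
  have hrow : ∀ p i, ∑ j, x p i j = k / t p * min (s i p) 1 := by
    intro p i
    simp only [x]
    rw [← Finset.sum_div, ← Finset.mul_sum]
    change k * s i p / (max (s i p) 1 * t p) = _
    have h := min_mul_max (s i p) 1
    have h1 := (hmax i p).ne'
    have h2 := (ht0 p).ne'
    field_simp
    linarith
  have hcont : ∀ j, Continuous fun p => ∑ i, x p i j := by
    intro j
    refine continuous_finsetSum _ fun i _ => ?_
    have hsc : ∀ i, Continuous (s i) := fun i =>
      continuous_finsetSum _ fun j _ => (f i j).continuous
    refine Continuous.div (continuous_const.mul (f i j).continuous) ?_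
      fun p => (mul_pos (hmax i p) (ht0 p)).ne'
    exact ((hsc i).max continuous_const).mul
      (continuous_finsetSum _ fun i _ => (hsc i).min continuous_const)
  obtain ⟨p, hp⟩ := exists_mem_closed_cover hk hR (fun j => {p | 1 ≤ ∑ i, x p i j})
    (fun j => isClosed_le continuous_const (hcont j)) (by
      intro p
      by_contra! hcon
      have h1 : ∑ j, ∑ i, x p i j = k := by
        rw [Finset.sum_comm]
        simp only [hrow]
        rw [← Finset.mul_sum]
        change k / t p * t p = k
        exact div_mul_cancel₀ _ (ht0 p).ne'
      have h2 : ∑ j, ∑ i, x p i j < ∑ j : Fin k, (1 : ℝ) :=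
        Finset.sum_lt_sum_of_nonempty ⟨⟨0, hk⟩, Finset.mem_univ _⟩
          fun j _ => not_le.mp (hcon j)
      simp [h1] at h2)
  have hxU : ∀ i j, 0 < x p i j → p ∈ U i j := by
    intro i j h
    by_contra hne
    have h0 : f i j p = 0 := hf0 i j hne
    simp [x, h0] at h
  have hcol : ∀ j, 1 ≤ ∑ i, x p i j := by
    by_contra! hcon
    obtain ⟨j₀, hj₀⟩ := hcon
    have hfree : p.1 j₀ = 0 := (hp j₀).resolve_left (not_le.mpr hj₀)
    -- A room that is not free has column sum at least 1, so `p` lies in some `U i j`; as `j₀` is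
    -- free, `hU` bounds its price.
    have hsmall : ∀ j, p.1 j < R / k := by
      intro j
      rcases hp j with h | h
      · obtain ⟨i, -, hi⟩ := Finset.exists_lt_of_sum_lt (s := Finset.univ)
          (f := fun _ => (0 : ℝ)) (g := fun i => x p i j)
          (by simpa using lt_of_lt_of_le one_pos h)
        exact hU i j p (hxU i j hi) ⟨j₀, hfree⟩
      · rw [h]
        positivity
    have h := Finset.sum_lt_sum_of_nonempty (s := Finset.univ) ⟨j₀, Finset.mem_univ _⟩
      fun j _ => hsmall j
    rw [p.2.2, Finset.sum_const, Finset.card_univ, Fintype.card_fin, nsmul_eq_mul,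
      mul_div_cancel₀ _ hk'.ne'] at h
    exact lt_irrefl _ h
  obtain ⟨τ, hτ, hpos⟩ := exists_injective_pos_of_sums (x p) (hx0 p) (fun i => by
    rw [hrow]
    exact mul_le_one₀ ((div_le_one (ht0 p)).mpr (ht p)) (le_min (hs0 i p) zero_le_one)
      (min_le_right _ _)) hcol
  exact ⟨p, τ, hτ, fun j => hxU _ _ (hpos j)⟩

theorem theorem1p4 (k n : ℕ) (hk : 0 < k) (hkn : k ≤ n) (R : ℝ) (hR : 0 < R)
    (A : Fin n → Preferences k R)
    (hclosed : ∀ i, (A i).HasClosedPreferences)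
    (hfree : ∀ i, (A i).AcceptsOnlyFreeIfFree)
    (haccept : ∀ (p : PriceDistribution k R) (C : Finset (Fin n)), C.card = n - k + 1 →
      ∃ i ∈ C, (A i p).Nonempty) :
    ∃ (p : PriceDistribution k R) (tenant : Fin k → Fin n),
      Function.Injective tenant ∧ ∀ j : Fin k, j ∈ A (tenant j) p := by
  classical
  have := PriceDistribution.compactSpace k R
  have hk' : (0 : ℝ) < k := by exact_mod_cast hk
  have hmany : ∀ p, ∃ S : Finset (Fin n), k ≤ S.card ∧ ∀ i ∈ S, ∃ j, p ∈ {p | j ∈ A i p} := by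
    intro p
    refine ⟨Finset.univ.filter fun i => (A i p).Nonempty, ?_, fun i hi =>
      (Finset.mem_filter.mp hi).2⟩
    by_contra! hlt
    have h := Finset.card_filter_add_card_filter_not (s := (Finset.univ : Finset (Fin n)))
      fun i => (A i p).Nonempty
    rw [Finset.card_univ, Fintype.card_fin] at h
    obtain ⟨C, hC, hCcard⟩ := Finset.exists_subset_card_eq (n := n - k + 1)
      (s := Finset.univ.filter fun i => ¬(A i p).Nonempty) (by omega)
    obtain ⟨i, hi, hne⟩ := haccept p C hCcard
    exact (Finset.mem_filter.mp (hC hi)).2 hne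
  -- By (2) the closed set `K j` misses all prices at which `j` is accepted. Removing it from a
  -- thickening leaves an open neighbourhood on which (2) survives as a price below `R / k`.
  let K : Fin k → Set (PriceDistribution k R) := fun j => {p | (∃ j', p.1 j' = 0) ∧ R / k ≤ p.1 j}
  have hcoord : ∀ j, Continuous fun p : PriceDistribution k R => p.1 j := fun j =>
    (continuous_apply j).comp continuous_subtype_val
  have hK : ∀ j, IsClosed (K j) := by
    intro j
    refine IsClosed.inter ?_ (isClosed_le continuous_const (hcoord j))
    change IsClosed {p : PriceDistribution k R | ∃ j', p.1 j' = 0}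
    rw [Set.ofPred_exists]
    exact isClosed_iUnion_of_finite fun j' => isClosed_eq (hcoord j') continuous_const
  have hstep : ∀ m : ℕ, ∃ (p : PriceDistribution k R) (τ : Fin k → Fin n),
      Function.Injective τ ∧
        ∀ j, p ∈ Metric.thickening (1 / ((m : ℝ) + 1)) {p | j ∈ A (τ j) p} \ K j := by
    intro m
    refine exists_assignment_of_isOpen hk hR (fun i j => {p | j ∈ A i p})
      (fun i j => Metric.thickening (1 / ((m : ℝ) + 1)) {p | j ∈ A i p} \ K j)
      (fun i j => hclosed i j) (fun i j => Metric.isOpen_thickening.sdiff (hK j))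
      (fun i j p hp => ⟨Metric.self_subset_thickening (by positivity) _ hp, fun hpK => ?_⟩)
      (fun i j p hp hex => not_le.mp fun hle => hp.2 ⟨hex, hle⟩) hmany
    have h0 := hfree i p hpK.1 j hp
    have h1 : R / k ≤ p.1 j := hpK.2
    have h2 : 0 < R / k := by positivity
    linarith
  choose p τ hτ hp using hstep
  obtain ⟨τ₀, hτ₀⟩ := (Filter.hyperfilter ℕ).exists_eventually_eq τ
  have hlim : Filter.Tendsto p (Filter.hyperfilter ℕ)
      (nhds ((Filter.hyperfilter ℕ).map p).lim) := ((Filter.hyperfilter ℕ).map p).le_nhds_lim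
  refine ⟨((Filter.hyperfilter ℕ).map p).lim, τ₀, ?_, fun j => ?_⟩
  · obtain ⟨m, rfl⟩ := hτ₀.exists
    exact hτ m
  · refine mem_of_tendsto_of_eventually_near Nat.hyperfilter_le_atTop hlim
      (hclosed (τ₀ j) j) 1 ?_
    filter_upwards [hτ₀] with m hm
    obtain ⟨b, hb, hdist⟩ := Metric.mem_thickening_iff.mp (hp m j).1
    exact ⟨b, hm ▸ hb, by rw [one_mul]; exact hdist.le⟩
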